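/- Let $G$ be a finite $2$-edge-connected cubic multigraph of order $n$ in which no four vertices induce a claw $K_{1,3}$ or a diamond $K_4-e$, and suppose that there is exactly one pair $\{u,v\}$ of distinct vertices that is joined by two edges. (A loop counts twice for the degree, and $2$-edge-connected means connected and still connected after the deletion of any one edge.) For a set $S\subseteq V(G)$, observe the vertices of $S$ and all edges incident with them, and then apply the following rules as long as possible: (1) a vertex incident with an observed edge is observed; (2) an edge joining two observed vertices is observed; (3) if a vertex is incident with $k>1$ edges, parallel edges counted separately, and $k-1$ of them are observed, then all $k$ are observed. The set $S$ is power dominating if all vertices and edges of $G$ are eventually observed, and $\gamma_P(G)$ is the least cardinality of a power dominating set of $G$. Then $$\gamma_P(G)\le\frac{n-2}{6}.$$ Moreover, $u$ has exactly one neighbour $w\ne v$ and $v$ has exactly one neighbour $z\ne u$, where $w,z\notin\{u,v\}$, and there is a power dominating set $D$ of $G$ with $|D|\le\frac{n-2}{6}$ and $D\cap\{u,v,w,z\}=\emptyset$ such that $w$ eventually observes $u$ and $z$ eventually observes $v$: at some time $w$ is observed, $u$ is not, and the edge $wu$ is the only unobserved edge at $w$, and likewise for $z$ and $v$. -/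

import Mathlib

namespace Graph

/-- The degree of `x` in a multigraph: the number of edges at `x`, where a loop counts twice. -/
noncomputable def edegree {α β : Type*} (G : Graph α β) (x : α) : ℕ∞ :=
  (G.incidenceSet x).encard + (G.loopSet x).encard

/-- Every vertex has degree three. -/
def IsCubic {α β : Type*} (G : Graph α β) : Prop :=
  ∀ x ∈ G.vertexSet, G.edegree x = 3

/-- The multigraph is connected and stays connected when any one edge is deleted. Connectivity does
not depend on multiplicities, so it is that of the underlying simple graph on the vertex set. -/
def TwoEdgeConnected {α β : Type*} (G : Graph α β) : Prop :=
  G.toSimpleGraph.Connected ∧ ∀ e ∈ G.edgeSet, (G.deleteEdges {e}).toSimpleGraph.Connected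

/-- No four distinct vertices induce a claw `K_{1,3}` (with centre `x`). -/
def ClawFree {α β : Type*} (G : Graph α β) : Prop :=
  ¬ ∃ x a b c, x ≠ a ∧ x ≠ b ∧ x ≠ c ∧ a ≠ b ∧ a ≠ c ∧ b ≠ c ∧
    G.Adj x a ∧ G.Adj x b ∧ G.Adj x c ∧ ¬ G.Adj a b ∧ ¬ G.Adj a c ∧ ¬ G.Adj b c

/-- No four distinct vertices induce a diamond `K₄ - e` (the missing edge being `ad`). -/
def DiamondFree {α β : Type*} (G : Graph α β) : Prop :=
  ¬ ∃ a b c d, a ≠ b ∧ a ≠ c ∧ a ≠ d ∧ b ≠ c ∧ b ≠ d ∧ c ≠ d ∧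
    G.Adj a b ∧ G.Adj a c ∧ G.Adj b c ∧ G.Adj b d ∧ G.Adj c d ∧ ¬ G.Adj a d

/-- `{u, v}` is the one and only pair of vertices that is joined by two edges. -/
def IsUniqueDoubledPair {α β : Type*} (G : Graph α β) (u v : α) : Prop :=
  u ≠ v ∧ ∀ x y, x ≠ y → ({e | G.IsLink e x y}.encard = 2 ↔ s(x, y) = s(u, v))

/-- A vertex is observed, once the edges in `F` are, if it is in `S` or meets an observed edge. -/
def observedVertices {α β : Type*} (G : Graph α β) (S : Set α) (F : Set β) : Set α :=
  {x | x ∈ S ∨ ∃ e ∈ F, G.Inc e x}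

/-- The edges observed after `i` rounds. At the start these are the edges that meet `S`. In every
round an edge is added if both of its ends are observed, or if it is the only unobserved one of
the `k > 1` edges at some vertex. -/
def observedEdges {α β : Type*} (G : Graph α β) (S : Set α) : ℕ → Set β
  | 0 => {e | ∃ x ∈ S, G.Inc e x}
  | i + 1 => observedEdges G S i
      ∪ {e | ∃ x y, G.IsLink e x y ∧ x ∈ G.observedVertices S (observedEdges G S i) ∧
          y ∈ G.observedVertices S (observedEdges G S i)}
      ∪ {e | ∃ x, G.Inc e x ∧ (∃ f, f ≠ e ∧ G.Inc f x) ∧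
          ∀ f, f ≠ e → G.Inc f x → f ∈ observedEdges G S i}

/-- The set `S` of vertices eventually observes all vertices and all edges. -/
def IsPowerDominating {α β : Type*} (G : Graph α β) (S : Set α) : Prop :=
  S ⊆ G.vertexSet ∧
  (∀ x ∈ G.vertexSet, ∃ i, x ∈ G.observedVertices S (G.observedEdges S i)) ∧
  (∀ e ∈ G.edgeSet, ∃ i, e ∈ G.observedEdges S i)

/-- The least size of a (finite) power dominating set. -/
noncomputable def powerDominationNumber {α β : Type*} (G : Graph α β) : ℕ :=
  sInf {k | ∃ S : Finset α, G.IsPowerDominating (S : Set α) ∧ S.card = k}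

/-- In the process started from `S`, the vertex `y` is observed by `x` in a propagation step: in
some round `x` is observed, `y` is not, and all edges at `x` are observed except for one, which
leads to `y`. -/
def EventuallyObserves {α β : Type*} (G : Graph α β) (S : Set α) (x y : α) : Prop :=
  ∃ i e, x ∈ G.observedVertices S (G.observedEdges S i) ∧
    y ∉ G.observedVertices S (G.observedEdges S i) ∧
    G.IsLink e x y ∧ ∀ f, f ≠ e → G.Inc f x → f ∈ G.observedEdges S i

end Graph

/-! By two-edge-connectedness there are no loops, the two outer neighbours `w` of `u` and `z` of `v`
are distinct, and off the doubled pair the graph is simple. A vertex off the pair has two adjacent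
neighbours because there is no claw; its third neighbour is adjacent to neither of them, since
otherwise there is a diamond or a component `K₄`. Hence the other `n - 2` vertices split into `(n -
2) / 3` triangles, each vertex having one neighbour `r x` outside its triangle.

Replace the path `w u v z` by an edge `wz` (`bypass`). Since `w` and `z` lie in different triangles,
contracting the triangles gives a loopless cubic multigraph. In a maximum cut of it every vertex has
at most one edge inside its own side (`Finset.exists_coloring_of_involution`). Let `C` be the
smaller side and let `D` contain one vertex of each triangle in `C`, other than `w` and `z`; then
`|D| ≤ (n - 2) / 6`.

A triangle in `C` is observed with its outer edges, and any triangle is observed once two of its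
outer edges are. A triangle outside `C` has at least two outer edges to `C`, which suffices unless
one of them is the fictitious edge `wz`. In that case the triangle at the other end is in `C`, and
the two genuine outer edges lead to triangles that contain neither `w` nor `z` or lie in `C`, so
these are observed without using `wz` (`IsTrianglePartition.edgeObserved`). Finally `w` and `z`
force `u` and `v`: neither doubled edge can be observed before the third edges at both of its ends.
-/

namespace Graph

/-! ### Edge cuts, loops and multiplicities -/

variable {α β : Type*} {G : Graph α β}

/-- A path from `x` to `y` that avoids `e` has to leave `W`. All later arguments that exclude
bridges and small components use this form. -/
theorem TwoEdgeConnected.exists_isLink_boundary (h : G.TwoEdgeConnected) (e : β) (W : Set α)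
    {x y : α} (hx : x ∈ G.vertexSet) (hxW : x ∈ W) (hy : y ∈ G.vertexSet) (hyW : y ∉ W) :
    ∃ f a b, f ≠ e ∧ G.IsLink f a b ∧ a ∈ W ∧ b ∉ W := by
  by_cases he : e ∈ G.edgeSet
  · obtain ⟨p⟩ := (h.2 e he).preconnected ⟨x, hx⟩ ⟨y, hy⟩
    obtain ⟨d, -, h1, h2⟩ := p.exists_boundary_dart {a | (a : α) ∈ W} hxW hyW
    obtain ⟨-, f, hf⟩ := d.adj
    have hf' : G.IsLink f d.fst d.snd ∧ f ∉ ({e} : Set β) := hf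
    exact ⟨f, _, _, hf'.2, hf'.1, h1, h2⟩
  · obtain ⟨p⟩ := h.1.preconnected ⟨x, hx⟩ ⟨y, hy⟩
    obtain ⟨d, -, h1, h2⟩ := p.exists_boundary_dart {a | (a : α) ∈ W} hxW hyW
    obtain ⟨-, f, hf⟩ := d.adj
    exact ⟨f, _, _, by rintro rfl; exact he hf.edge_mem, hf, h1, h2⟩

/-- Besides the loop, which counts twice, at least two edges leave `x`, so the degree would be at
least four. The pair `u ≠ v` only supplies a second vertex. -/
theorem TwoEdgeConnected.not_isLink_self (h : G.TwoEdgeConnected) (hc : G.IsCubic) {u v : α}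
    (hu : u ∈ G.vertexSet) (hv : v ∈ G.vertexSet) (huv : u ≠ v) (e : β) (x : α) :
    ¬ G.IsLink e x x := by
  intro he
  have hx := he.left_mem
  obtain ⟨y, hy, hyx⟩ : ∃ y ∈ G.vertexSet, y ≠ x := by
    by_cases hux : u = x
    · exact ⟨v, hv, fun hvx => huv (hux.trans hvx.symm)⟩
    · exact ⟨u, hu, hux⟩
  obtain ⟨f, a, b, hfe, hab, ha, hb⟩ := h.exists_isLink_boundary e {x} hx rfl hy hyx
  obtain ⟨g, a', b', hgf, hab', ha', hb'⟩ := h.exists_isLink_boundary f {x} hx rfl hy hyx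
  rw [Set.mem_singleton_iff.1 ha] at hab
  rw [Set.mem_singleton_iff.1 ha'] at hab'
  have hge : g ≠ e := by
    rintro rfl
    exact hb' (hab'.right_unique he)
  have h1 : ({e, f, g} : Set β).encard = 3 :=
    Set.encard_eq_three.2 ⟨e, f, g, hfe.symm, hge.symm, hgf.symm, rfl⟩
  have h2 : ({e, f, g} : Set β) ⊆ G.incidenceSet x := by
    rintro k (rfl | rfl | rfl)
    exacts [he.inc_left, hab.inc_left, hab'.inc_left]
  have h3 : (1 : ℕ∞) ≤ (G.loopSet x).encard :=
    Set.one_le_encard_iff_nonempty.2 ⟨e, he⟩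
  have h4 := hc x hx
  have h5 : (3 : ℕ∞) + 1 ≤ 3 := by
    calc (3 : ℕ∞) + 1 ≤ _ := add_le_add (h1 ▸ Set.encard_le_encard h2) h3
      _ = 3 := h4
  exact absurd h5 (by decide)

theorem IsUniqueDoubledPair.symm {u v : α} (h : G.IsUniqueDoubledPair u v) :
    G.IsUniqueDoubledPair v u :=
  ⟨h.1.symm, fun x y hxy => by rw [h.2 x y hxy, Sym2.eq_swap (a := u)]⟩

theorem IsUniqueDoubledPair.encard_eq {u v : α} (h : G.IsUniqueDoubledPair u v) :
    {e | G.IsLink e u v}.encard = 2 :=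
  (h.2 u v h.1).2 rfl

theorem IsUniqueDoubledPair.exists_isLink {u v : α} (h : G.IsUniqueDoubledPair u v) :
    ∃ f g, f ≠ g ∧ {e | G.IsLink e u v} = {f, g} :=
  Set.encard_eq_two.1 h.encard_eq

theorem IsUniqueDoubledPair.mem {u v : α} (h : G.IsUniqueDoubledPair u v) :
    u ∈ G.vertexSet ∧ v ∈ G.vertexSet := by
  obtain ⟨f, g, -, hfg⟩ := h.exists_isLink
  have : G.IsLink f u v := by
    change f ∈ {e | G.IsLink e u v}
    simp [hfg]
  exact ⟨this.left_mem, this.right_mem⟩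

theorem IsCubic.exists_inc_iff (hc : G.IsCubic) (hl : ∀ e x, ¬ G.IsLink e x x) {x : α}
    (hx : x ∈ G.vertexSet) :
    ∃ e f g, e ≠ f ∧ e ≠ g ∧ f ≠ g ∧ ∀ k, G.Inc k x ↔ k = e ∨ k = f ∨ k = g := by
  have h0 : G.loopSet x = ∅ := Set.eq_empty_of_forall_notMem fun e he => hl e x he
  have h1 := hc x hx
  rw [edegree, h0, Set.encard_empty, add_zero, Set.encard_eq_three] at h1
  obtain ⟨e, f, g, h1, h2, h3, h4⟩ := h1
  exact ⟨e, f, g, h1, h2, h3, fun k => by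
    rw [← mem_incidenceSet, h4]; simp⟩

/-- The edges at either vertex of the doubled pair. -/
theorem IsUniqueDoubledPair.exists_inc_iff {u v : α} (h : G.IsUniqueDoubledPair u v)
    (hc : G.IsCubic) (hl : ∀ e x, ¬ G.IsLink e x x) :
    ∃ w f g e, f ≠ g ∧ G.IsLink f u v ∧ G.IsLink g u v ∧ G.IsLink e u w ∧ w ≠ u ∧ w ≠ v ∧
      ∀ k, G.Inc k u → k = f ∨ k = g ∨ k = e := by
  obtain ⟨f, g, hfg, hS⟩ := h.exists_isLink
  have hl' : ∀ k, G.IsLink k u v ↔ k = f ∨ k = g := fun k => by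
    change k ∈ {e | G.IsLink e u v} ↔ _
    simp [hS]
  have hf := (hl' f).2 (.inl rfl)
  have hg := (hl' g).2 (.inr rfl)
  obtain ⟨a, b, c, hab, hac, hbc, habc⟩ := hc.exists_inc_iff hl h.mem.1
  have h1 := (habc f).1 hf.inc_left
  have h2 := (habc g).1 hg.inc_left
  obtain ⟨e, he, hef, heg⟩ : ∃ e, G.Inc e u ∧ e ≠ f ∧ e ≠ g := by
    rcases h1 with rfl | rfl | rfl <;> rcases h2 with rfl | rfl | rfl <;>
      first
      | exact absurd rfl hfg
      | exact ⟨a, (habc a).2 (by simp), by grind, by grind⟩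
      | exact ⟨b, (habc b).2 (by simp), by grind, by grind⟩
      | exact ⟨c, (habc c).2 (by simp), by grind, by grind⟩
  obtain ⟨w, hw⟩ := he
  refine ⟨w, f, g, e, hfg, hf, hg, hw, ?_, ?_, ?_⟩
  · rintro rfl; exact hl _ _ hw
  · rintro rfl; have := (hl' e).1 hw; tauto
  · intro k hk
    have h3 := (habc e).1 hw.inc_left
    have h4 := (habc k).1 hk
    grind

/-- Away from the doubled pair, the graph is simple. -/
theorem IsUniqueDoubledPair.exists_adj_iff {u v : α} (h : G.IsUniqueDoubledPair u v)
    (hc : G.IsCubic) (h2 : G.TwoEdgeConnected) (hl : ∀ e x, ¬ G.IsLink e x x) {x : α}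
    (hx : x ∈ G.vertexSet) (hxu : x ≠ u) (hxv : x ≠ v) :
    (∃ a b c, a ≠ b ∧ a ≠ c ∧ b ≠ c ∧ ∀ y, G.Adj x y ↔ y = a ∨ y = b ∨ y = c) ∧
      ∀ e f y, G.IsLink e x y → G.IsLink f x y → e = f := by
  have huniq : ∀ e f y, G.IsLink e x y → G.IsLink f x y → e = f := by
    intro e f y he hf
    by_contra hef
    have hxy : x ≠ y := by rintro rfl; exact hl _ _ he
    have hne : {k | G.IsLink k x y}.encard ≠ 2 := by
      rw [Ne, h.2 x y hxy, Sym2.eq_iff]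
      tauto
    -- Exactly two parallel edges would be a second doubled pair, so there is a third one. Then `x`
    -- and `y` have no other edges and form a component, which misses `u` or `v`.
    obtain ⟨k, hk, hke, hkf⟩ : ∃ k, G.IsLink k x y ∧ k ≠ e ∧ k ≠ f := by
      by_contra! hcon
      refine hne (Set.encard_eq_two.2 ⟨e, f, hef, ?_⟩)
      ext k
      simp only [Set.mem_ofPred_eq, Set.mem_insert_iff, Set.mem_singleton_iff]
      constructor
      · intro hk
        by_cases hk' : k = e
        · exact .inl hk'
        · exact .inr (hcon k hk hk')
      · rintro (rfl | rfl) <;> assumption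
    have key : ∀ t, t ∈ G.vertexSet → G.Inc e t → G.Inc f t → G.Inc k t →
        ∀ m, G.Inc m t → m = e ∨ m = f ∨ m = k := by
      intro t ht h1 h2 h3 m hm
      obtain ⟨a, b, c, hab, hac, hbc, habc⟩ := hc.exists_inc_iff hl ht
      have := (habc _).1 h1
      have := (habc _).1 h2
      have := (habc _).1 h3
      have := (habc _).1 hm
      grind
    obtain ⟨t, ht, htx, hty⟩ : ∃ t ∈ G.vertexSet, t ≠ x ∧ t ≠ y := by
      by_cases huy : u = y
      · exact ⟨v, h.mem.2, hxv.symm, by rw [← huy]; exact h.1.symm⟩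
      · exact ⟨u, h.mem.1, hxu.symm, huy⟩
    obtain ⟨m, a, b, -, hm, ha, hb⟩ := h2.exists_isLink_boundary e {x, y} hx (by simp) ht
      (by simp [htx, hty])
    have hmx : m = e ∨ m = f ∨ m = k := by
      rcases ha with rfl | rfl
      · exact key _ hx he.inc_left hf.inc_left hk.inc_left m hm.inc_left
      · exact key _ he.right_mem he.inc_right hf.inc_right hk.inc_right m hm.inc_left
    have hmxy : G.IsLink m x y := by rcases hmx with rfl | rfl | rfl <;> assumption
    have := hm.right_eq_or_eq hmxy
    exact hb (by simpa using this)
  refine ⟨?_, huniq⟩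
  obtain ⟨e, f, g, hef, heg, hfg, hinc⟩ := hc.exists_inc_iff hl hx
  obtain ⟨a, ha⟩ := (hinc e).2 (by simp)
  obtain ⟨b, hb⟩ := (hinc f).2 (by simp)
  obtain ⟨c, hc⟩ := (hinc g).2 (by simp)
  refine ⟨a, b, c, ?_, ?_, ?_, ?_⟩
  · rintro rfl; exact hef (huniq _ _ _ ha hb)
  · rintro rfl; exact heg (huniq _ _ _ ha hc)
  · rintro rfl; exact hfg (huniq _ _ _ hb hc)
  · intro y
    constructor
    · rintro ⟨k, hk⟩
      rcases (hinc k).1 hk.inc_left with rfl | rfl | rfl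
      · exact .inl (hk.right_unique ha)
      · exact .inr (.inl (hk.right_unique hb))
      · exact .inr (.inr (hk.right_unique hc))
    · rintro (rfl | rfl | rfl)
      exacts [⟨_, ha⟩, ⟨_, hb⟩, ⟨_, hc⟩]

/-! ### Neighbourhoods around the doubled pair and triangles -/

/-- The adjacencies of a cubic graph that is simple away from the doubled pair `u`, `v`, whose
other neighbours are `w` and `z`. -/
structure DoubledPairFrame (G : Graph α β) (u v w z : α) : Prop where
  irrefl : ∀ x, ¬ G.Adj x x
  adj_left : ∀ y, G.Adj u y ↔ y = v ∨ y = w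
  adj_right : ∀ y, G.Adj v y ↔ y = u ∨ y = z
  ne : u ≠ v
  left_ne : w ≠ u ∧ w ≠ v
  right_ne : z ≠ u ∧ z ≠ v
  exists_adj_iff : ∀ x ∈ G.vertexSet, x ≠ u → x ≠ v →
    ∃ a b c, a ≠ b ∧ a ≠ c ∧ b ≠ c ∧ ∀ y, G.Adj x y ↔ y = a ∨ y = b ∨ y = c
  -- Two-edge-connectedness in terms of adjacency: as `a` is off the doubled pair, at most one edge
  -- joins `a` and `b`, so excluding the pair of ends is excluding a single edge.
  exists_boundary : ∀ (W : Set α) (a b x y : α), a ≠ u → a ≠ v → x ∈ G.vertexSet → x ∈ W →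
    y ∈ G.vertexSet → y ∉ W → ∃ p q, G.Adj p q ∧ p ∈ W ∧ q ∉ W ∧ ¬ (p = a ∧ q = b)

namespace DoubledPairFrame

variable {u v w z : α}

theorem symm (h : G.DoubledPairFrame u v w z) : G.DoubledPairFrame v u z w where
  irrefl := h.irrefl
  adj_left := h.adj_right
  adj_right := h.adj_left
  ne := h.ne.symm
  left_ne := h.right_ne.symm
  right_ne := h.left_ne.symm
  exists_adj_iff x hx h1 h2 := h.exists_adj_iff x hx h2 h1
  exists_boundary W a b x y h1 h2 := h.exists_boundary W a b x y h2 h1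

theorem left_mem (h : G.DoubledPairFrame u v w z) : u ∈ G.vertexSet :=
  ((h.adj_left v).2 (.inl rfl)).left_mem

theorem left_nbr_mem (h : G.DoubledPairFrame u v w z) : w ∈ G.vertexSet :=
  ((h.adj_left w).2 (.inr rfl)).right_mem

/-- If `w = z`, then the third edge at `w` is a bridge that separates `{u, v, w}`. -/
theorem left_nbr_ne_right_nbr (h : G.DoubledPairFrame u v w z) : w ≠ z := by
  rintro rfl
  obtain ⟨a, b, c, hab, hac, hbc, hN⟩ := h.exists_adj_iff w h.left_nbr_mem h.left_ne.1 h.left_ne.2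
  have hu := (hN u).1 ((h.adj_left w).2 (.inr rfl)).symm
  have hv := (hN v).1 ((h.adj_right w).2 (.inr rfl)).symm
  have huv := h.ne
  obtain ⟨t, htu, htv, ht⟩ : ∃ t, t ≠ u ∧ t ≠ v ∧ ∀ y, G.Adj w y ↔ y = u ∨ y = v ∨ y = t := by
    rcases hu with rfl | rfl | rfl <;> rcases hv with rfl | rfl | rfl <;>
      first
      | exact absurd rfl huv
      | exact ⟨a, by assumption, by assumption, by grind⟩
      | exact ⟨b, by grind, by grind, by grind⟩
      | exact ⟨c, by grind, by grind, by grind⟩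
  have htw : t ≠ w := by
    rintro rfl
    exact h.irrefl t ((ht t).2 (by simp))
  obtain ⟨p, q, hpq, hp, hq, hne⟩ := h.exists_boundary {u, v, w} w t u t h.left_ne.1 h.left_ne.2
    h.left_mem (by simp) ((ht t).2 (by simp)).right_mem (by simp [*])
  simp only [Set.mem_insert_iff, Set.mem_singleton_iff, not_or] at hp hq
  rcases hp with rfl | rfl | rfl
  · have := (h.adj_left q).1 hpq; tauto
  · have := (h.adj_right q).1 hpq; tauto
  · have := (ht q).1 hpq; tauto

/-- Every vertex off the doubled pair lies in a triangle off the pair, and its third neighbour is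
adjacent to neither of the others. -/
theorem exists_triangle (h : G.DoubledPairFrame u v w z) (hclaw : G.ClawFree)
    (hdiamond : G.DiamondFree) {x : α} (hx : x ∈ G.vertexSet) (hxu : x ≠ u) (hxv : x ≠ v) :
    ∃ a b r, a ≠ b ∧ a ≠ r ∧ b ≠ r ∧ (∀ y, G.Adj x y ↔ y = a ∨ y = b ∨ y = r) ∧
      G.Adj a b ∧ ¬ G.Adj a r ∧ ¬ G.Adj b r ∧ a ≠ u ∧ a ≠ v ∧ b ≠ u ∧ b ≠ v := by
  obtain ⟨a, b, c, hab, hac, hbc, hN⟩ := h.exists_adj_iff x hx hxu hxv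
  have hwz := h.left_nbr_ne_right_nbr
  have hirr := h.irrefl
  have hL := h.adj_left
  have hR := h.adj_right
  obtain ⟨a, b, r, hab, har, hbr, hN, hadj⟩ : ∃ a b r, a ≠ b ∧ a ≠ r ∧ b ≠ r ∧
      (∀ y, G.Adj x y ↔ y = a ∨ y = b ∨ y = r) ∧ G.Adj a b := by
    have hxa : G.Adj x a := (hN a).2 (by simp)
    have hxb : G.Adj x b := (hN b).2 (by simp)
    have hxc : G.Adj x c := (hN c).2 (by simp)
    by_cases h1 : G.Adj a b
    · exact ⟨a, b, c, hab, hac, hbc, hN, h1⟩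
    by_cases h2 : G.Adj a c
    · exact ⟨a, c, b, hac, hab, hbc.symm, by grind, h2⟩
    by_cases h3 : G.Adj b c
    · exact ⟨b, c, a, hbc, hab.symm, hac.symm, by grind, h3⟩
    refine (hclaw ⟨x, a, b, c, ?_, ?_, ?_, hab, hac, hbc, hxa, hxb, hxc, h1, h2, h3⟩).elim <;>
      rintro rfl
    exacts [hirr _ hxa, hirr _ hxb, hirr _ hxc]
  have hxa : G.Adj x a := (hN a).2 (by simp)
  have hxb : G.Adj x b := (hN b).2 (by simp)
  have hxr : G.Adj x r := (hN r).2 (by simp)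
  -- A triangle through `x` and `u` would have to be `u`, `v`, `w`, which makes `w` a neighbour of
  -- `v`, that is, `w = z`.
  have hmem : ∀ s t, G.Adj x s → G.Adj x t → G.Adj s t → s ≠ u := by
    rintro s t hs ht hst rfl
    have h1 := (hL x).1 hs.symm
    have h2 := (hL t).1 hst
    have hxw : x = w := by tauto
    subst hxw
    rcases h2 with rfl | rfl
    · have := (hR x).1 ht.symm
      tauto
    · exact hirr _ ht
  have hmem' : ∀ s t, G.Adj x s → G.Adj x t → G.Adj s t → s ≠ v := by
    rintro s t hs ht hst rfl
    have h1 := (hR x).1 hs.symm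
    have h2 := (hR t).1 hst
    have hxw : x = z := by tauto
    subst hxw
    rcases h2 with rfl | rfl
    · have := (hL x).1 ht.symm
      tauto
    · exact hirr _ ht
  -- Otherwise `x`, `a`, `b`, `r` form a `K₄`, which is a whole component and misses `u`.
  have hK : ¬ (G.Adj a r ∧ G.Adj b r) := by
    rintro ⟨har', hbr'⟩
    have hdeg : ∀ s t m n, s ≠ u → s ≠ v → t ≠ m → t ≠ n → m ≠ n → G.Adj s t → G.Adj s m →
        G.Adj s n → ∀ y, G.Adj s y → y = t ∨ y = m ∨ y = n := by
      intro s t m n hsu hsv htm htn hmn ht hm hn y hy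
      obtain ⟨a', b', c', h1, h2, h3, h4⟩ := h.exists_adj_iff s ht.left_mem hsu hsv
      rw [h4] at ht hm hn hy
      grind
    have hxa' : x ≠ a := by rintro rfl; exact hirr _ hxa
    have hxb' : x ≠ b := by rintro rfl; exact hirr _ hxb
    have hxr' : x ≠ r := by rintro rfl; exact hirr _ hxr
    have hau := hmem a b hxa hxb hadj
    have hav := hmem' a b hxa hxb hadj
    have hbu := hmem b a hxb hxa hadj.symm
    have hbv := hmem' b a hxb hxa hadj.symm
    have hru := hmem r a hxr hxa har'.symm
    have hrv := hmem' r a hxr hxa har'.symm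
    obtain ⟨p, q, hpq, hp, hq, -⟩ := h.exists_boundary {x, a, b, r} x x x u hxu hxv hx (by simp)
      h.left_mem (by simp [hxu.symm, hau.symm, hbu.symm, hru.symm])
    simp only [Set.mem_insert_iff, Set.mem_singleton_iff, not_or] at hp hq
    rcases hp with rfl | rfl | rfl | rfl
    · have := (hN q).1 hpq; tauto
    · have := hdeg p x b r hau hav hxb' hxr' hbr hxa.symm hadj har' q hpq; tauto
    · have := hdeg p x a r hbu hbv hxa' hxr' har hxb.symm hadj.symm hbr' q hpq; tauto
    · have := hdeg p x a b hru hrv hxa' hxb' hab hxr.symm har'.symm hbr'.symm q hpq; tauto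
  have hD : ∀ s t, s ≠ t → s ≠ r → t ≠ r → G.Adj x s → G.Adj x t → G.Adj s t → G.Adj s r →
      G.Adj t r := by
    intro s t hst hsr htr hs ht hst' hsr'
    by_contra hcon
    refine hdiamond ⟨t, x, s, r, ?_, hst.symm, htr, ?_, ?_, hsr, ht.symm, hst'.symm, hs, hxr,
      hsr', hcon⟩ <;> rintro rfl
    exacts [hirr _ ht, hirr _ hs, hirr _ hxr]
  refine ⟨a, b, r, hab, har, hbr, hN, hadj, ?_, ?_, hmem a b hxa hxb hadj,
    hmem' a b hxa hxb hadj, hmem b a hxb hxa hadj.symm, hmem' b a hxb hxa hadj.symm⟩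
  · exact fun hh => hK ⟨hh, hD a b hab har hbr hxa hxb hadj hh⟩
  · exact fun hh => hK ⟨hD b a hab.symm hbr har hxb hxa hadj.symm hh, hh⟩

end DoubledPairFrame

/-! ### The partition into triangles -/

/-- The vertices other than `u` and `v` are partitioned into triangles `T x`, and `r x` is the
neighbour of `x` outside its triangle. -/
def IsTrianglePartition (G : Graph α β) (u v : α) (T : α → Set α) (r : α → α) : Prop :=
  ∀ x ∈ G.vertexSet, x ≠ u → x ≠ v →
    (∃ a b, a ≠ b ∧ x ≠ a ∧ x ≠ b ∧ a ≠ r x ∧ b ≠ r x ∧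
      (∀ y, G.Adj x y ↔ y = a ∨ y = b ∨ y = r x) ∧ T x = {x, a, b}) ∧
    (∀ y, y ∈ T x ↔ y ∈ G.vertexSet ∧ y ≠ u ∧ y ≠ v ∧ T y = T x) ∧
    (r x ≠ u → r x ≠ v → T (r x) ≠ T x ∧ r (r x) = x)

theorem DoubledPairFrame.exists_isTrianglePartition {u v w z : α}
    (h : G.DoubledPairFrame u v w z) (hclaw : G.ClawFree) (hdiamond : G.DiamondFree) :
    ∃ T r, G.IsTrianglePartition u v T r := by
  have key : ∀ x, ∃ (A : Set α) (r : α), x ∈ G.vertexSet → x ≠ u → x ≠ v →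
      ∃ a b, a ≠ b ∧ a ≠ r ∧ b ≠ r ∧ (∀ y, G.Adj x y ↔ y = a ∨ y = b ∨ y = r) ∧
      G.Adj a b ∧ ¬ G.Adj a r ∧ ¬ G.Adj b r ∧ a ≠ u ∧ a ≠ v ∧ b ≠ u ∧ b ≠ v ∧ A = {x, a, b} := by
    intro x
    by_cases hx : x ∈ G.vertexSet ∧ x ≠ u ∧ x ≠ v
    · obtain ⟨a, b, r, h'⟩ := h.exists_triangle hclaw hdiamond hx.1 hx.2.1 hx.2.2
      exact ⟨{x, a, b}, r, fun _ _ _ => ⟨a, b, by tauto⟩⟩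
    · exact ⟨∅, x, by tauto⟩
  choose T r hT using key
  have hirr := h.irrefl
  have hself : ∀ x ∈ G.vertexSet, x ≠ u → x ≠ v → x ∈ T x := by
    intro x hx hxu hxv
    obtain ⟨a, b, -, -, -, -, -, -, -, -, -, -, -, hTx⟩ := hT x hx hxu hxv
    simp [hTx]
  have hclass : ∀ x ∈ G.vertexSet, x ≠ u → x ≠ v → ∀ y ∈ T x,
      y ∈ G.vertexSet ∧ y ≠ u ∧ y ≠ v ∧ T y = T x := by
    -- The outer neighbour of `a` is adjacent to no other neighbour of `a`, so two adjacent
    -- neighbours of `a` are the other two vertices of its triangle.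
    have hstep : ∀ x a b, x ≠ b → a ∈ G.vertexSet → a ≠ u → a ≠ v → G.Adj a x → G.Adj a b →
        G.Adj x b → T a = {x, a, b} := by
      intro x a b hxb ha hau hav h1 h2 h3
      obtain ⟨a', b', k1, k2, k3, k4, k5, k6, k7, k8, k9, k10, k11, k12⟩ := hT a ha hau hav
      rw [k12]
      have h1' := (k4 x).1 h1
      have h2' := (k4 b).1 h2
      have h3' := h3.symm
      have : (x = a' ∧ b = b') ∨ (x = b' ∧ b = a') := by
        rcases h1' with e | e | e <;> rcases h2' with e' | e' | e' <;> subst e <;> subst e' <;>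
          tauto
      ext t
      simp only [Set.mem_insert_iff, Set.mem_singleton_iff]
      rcases this with ⟨rfl, rfl⟩ | ⟨rfl, rfl⟩ <;> tauto
    intro x hx hxu hxv y hy
    obtain ⟨a, b, k1, k2, k3, k4, k5, k6, k7, k8, k9, k10, k11, k12⟩ := hT x hx hxu hxv
    have hxa : G.Adj x a := (k4 a).2 (by simp)
    have hxb : G.Adj x b := (k4 b).2 (by simp)
    rw [k12] at hy ⊢
    rcases hy with rfl | rfl | rfl
    · exact ⟨hx, hxu, hxv, k12⟩
    · exact ⟨hxa.right_mem, k8, k9, hstep x y b (by rintro rfl; exact hirr _ hxb) hxa.right_mem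
        k8 k9 hxa.symm k5 hxb⟩
    · refine ⟨hxb.right_mem, k10, k11, ?_⟩
      rw [hstep x y a (by rintro rfl; exact hirr _ hxa) hxb.right_mem k10 k11 hxb.symm k5.symm hxa]
      ext t
      simp only [Set.mem_insert_iff, Set.mem_singleton_iff]
      tauto
  refine ⟨T, r, fun x hx hxu hxv => ?_⟩
  have hTx := hT x hx hxu hxv
  obtain ⟨a, b, k1, k2, k3, k4, k5, k6, k7, k8, k9, k10, k11, k12⟩ := hT x hx hxu hxv
  have hxa : G.Adj x a := (k4 a).2 (by simp)
  have hxb : G.Adj x b := (k4 b).2 (by simp)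
  have hxr : G.Adj x (r x) := (k4 (r x)).2 (by simp)
  have hxa' : x ≠ a := by rintro rfl; exact hirr _ hxa
  have hxb' : x ≠ b := by rintro rfl; exact hirr _ hxb
  have hxr' : r x ≠ x := fun hh => by rw [hh] at hxr; exact hirr _ hxr
  refine ⟨⟨a, b, k1, hxa', hxb', k2, k3, k4, k12⟩, fun y => ⟨hclass x hx hxu hxv y, ?_⟩, ?_⟩
  · rintro ⟨hy, hyu, hyv, hTy⟩
    exact hTy ▸ hself y hy hyu hyv
  · intro hru hrv
    have hne : r x ∉ T x := by
      rw [k12]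
      simp only [Set.mem_insert_iff, Set.mem_singleton_iff]
      tauto
    refine ⟨fun hh => hne (hh ▸ hself _ hxr.right_mem hru hrv), ?_⟩
    -- If `x` is not the outer neighbour of `r x`, it lies in the triangle of `r x`; the triangles
    -- then coincide and `r x ∈ T x`.
    by_contra hcon
    obtain ⟨a', b', l1, l2, l3, l4, l5, l6, l7, l8, l9, l10, l11, l12⟩ :=
      hT _ hxr.right_mem hru hrv
    refine hne ((hclass _ hxr.right_mem hru hrv x ?_).2.2.2 ▸ hself _ hxr.right_mem hru hrv)
    rw [l12]
    have := (l4 x).1 hxr.symm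
    simp only [Set.mem_insert_iff, Set.mem_singleton_iff]
    tauto

namespace IsTrianglePartition

variable {u v w z x y : α} {T : α → Set α} {r : α → α}

theorem self_mem (hT : G.IsTrianglePartition u v T r) (hx : x ∈ G.vertexSet) (hxu : x ≠ u)
    (hxv : x ≠ v) : x ∈ T x :=
  ((hT x hx hxu hxv).2.1 x).2 ⟨hx, hxu, hxv, rfl⟩

theorem adj_right (hT : G.IsTrianglePartition u v T r) (hx : x ∈ G.vertexSet) (hxu : x ≠ u)
    (hxv : x ≠ v) : G.Adj x (r x) := by
  obtain ⟨a, b, -, -, -, -, -, h, -⟩ := (hT x hx hxu hxv).1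
  exact (h _).2 (by simp)

theorem mem_or_eq_of_adj (hT : G.IsTrianglePartition u v T r) (hxu : x ≠ u)
    (hxv : x ≠ v) (hxy : G.Adj x y) : y ∈ T x ∨ y = r x := by
  obtain ⟨a, b, -, -, -, -, -, h, h'⟩ := (hT x hxy.left_mem hxu hxv).1
  rw [h']
  have := (h y).1 hxy
  simp only [Set.mem_insert_iff, Set.mem_singleton_iff]
  tauto

theorem adj_of_mem (hT : G.IsTrianglePartition u v T r) (hx : x ∈ G.vertexSet) (hxu : x ≠ u)
    (hxv : x ≠ v) (hy : y ∈ T x) (hyx : y ≠ x) : G.Adj x y := by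
  obtain ⟨a, b, -, -, -, -, -, h, h'⟩ := (hT x hx hxu hxv).1
  rw [h'] at hy
  rw [h]
  simp only [Set.mem_insert_iff, Set.mem_singleton_iff] at hy
  tauto

theorem right_notMem (hirr : ∀ x, ¬ G.Adj x x) (hT : G.IsTrianglePartition u v T r)
    (hx : x ∈ G.vertexSet) (hxu : x ≠ u) (hxv : x ≠ v) : r x ∉ T x := by
  have h0 := hT.adj_right hx hxu hxv
  obtain ⟨a, b, -, -, -, h1, h2, h, h'⟩ := (hT x hx hxu hxv).1
  rw [h']
  simp only [Set.mem_insert_iff, Set.mem_singleton_iff, not_or]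
  refine ⟨fun hh => ?_, h1.symm, h2.symm⟩
  rw [hh] at h0
  exact hirr _ h0

/-- Given two vertices of a triangle, there is a third. -/
theorem exists_third (hT : G.IsTrianglePartition u v T r) (hx : x ∈ G.vertexSet) (hxu : x ≠ u)
    (hxv : x ≠ v) (hy : y ∈ T x) (hyx : y ≠ x) :
    ∃ t ∈ T x, t ≠ x ∧ t ≠ y ∧ ∀ a ∈ T x, a = x ∨ a = y ∨ a = t := by
  obtain ⟨a, b, h1, h2, h3, -, -, -, h'⟩ := (hT x hx hxu hxv).1
  rw [h'] at hy ⊢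
  simp only [Set.mem_insert_iff, Set.mem_singleton_iff] at hy ⊢
  rcases hy with rfl | rfl | rfl
  · exact absurd rfl hyx
  · exact ⟨b, by grind⟩
  · exact ⟨a, by grind⟩

theorem right_left (hT : G.IsTrianglePartition u v T r) (h : G.DoubledPairFrame u v w z) :
    r w = u := by
  rcases hT.mem_or_eq_of_adj h.left_ne.1 h.left_ne.2 ((h.adj_left w).2 (.inr rfl)).symm with h1 | h1
  · exact absurd rfl (((hT w h.left_nbr_mem h.left_ne.1 h.left_ne.2).2.1 u).1 h1).2.1
  · exact h1.symm

theorem symm (hT : G.IsTrianglePartition u v T r) : G.IsTrianglePartition v u T r := by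
  intro x hx h1 h2
  obtain ⟨k1, k2, k3⟩ := hT x hx h2 h1
  exact ⟨k1, fun y => by rw [k2]; tauto, fun a b => k3 b a⟩

/-- If `w` and `z` share a triangle, the outer edge of its third vertex is a bridge separating this
triangle and `u`, `v` from the rest. -/
theorem class_ne (hT : G.IsTrianglePartition u v T r) (h : G.DoubledPairFrame u v w z) :
    T z ≠ T w := by
  intro hh
  have hw := h.left_nbr_mem
  have hz := h.symm.left_nbr_mem
  have hmem := (hT w hw h.left_ne.1 h.left_ne.2).2.1
  have hzT : z ∈ T w := (hmem z).2 ⟨hz, h.right_ne.1, h.right_ne.2, hh⟩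
  obtain ⟨b, hb, hbw, hbz, hall⟩ := hT.exists_third hw h.left_ne.1 h.left_ne.2 hzT
    h.left_nbr_ne_right_nbr.symm
  obtain ⟨hbV, hbu, hbv, hbT⟩ := (hmem b).1 hb
  have hadj := hT.adj_right hbV hbu hbv
  obtain ⟨p, q, hpq, hp, hq, hne⟩ := h.exists_boundary ({u, v} ∪ T w) b (r b) u (r b) hbu hbv
    h.left_mem (by simp) hadj.right_mem (by
      simp only [Set.mem_union, Set.mem_insert_iff, Set.mem_singleton_iff, not_or]
      refine ⟨⟨fun hc => ?_, fun hc => ?_⟩, hbT ▸ hT.right_notMem h.irrefl hbV hbu hbv⟩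
      · rw [hc] at hadj
        have := (h.adj_left b).1 hadj.symm
        tauto
      · rw [hc] at hadj
        have := (h.adj_right b).1 hadj.symm
        tauto)
  simp only [Set.mem_union, Set.mem_insert_iff, Set.mem_singleton_iff, not_or] at hp hq
  rcases hp with (rfl | rfl) | hp
  · rcases (h.adj_left q).1 hpq with rfl | rfl
    · exact hq.1.2 rfl
    · exact hq.2 (hT.self_mem hw h.left_ne.1 h.left_ne.2)
  · rcases (h.adj_right q).1 hpq with rfl | rfl
    · exact hq.1.1 rfl
    · exact hq.2 hzT
  · obtain ⟨hpV, hpu, hpv, hpT⟩ := (hmem p).1 hp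
    rcases hT.mem_or_eq_of_adj hpu hpv hpq with hqT | rfl
    · exact hq.2 (hpT ▸ hqT)
    · rcases hall p hp with rfl | rfl | rfl
      · exact hq.1.1 (hT.right_left h)
      · exact hq.1.2 (hT.symm.right_left h.symm)
      · exact hne ⟨rfl, rfl⟩

end IsTrianglePartition
end Graph


/-! ### Maximum cuts of cubic multigraphs -/

open scoped Finset in
/-- A colouring of the fibres of `q` in two colours such that in every fibre at most one point has
its partner under `p` in a fibre of the same colour. -/
theorem Finset.exists_coloring_of_involution {α Q : Type*} (s : Finset α) (p : α → α) (q : α → Q)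
    (hp : ∀ x ∈ s, p x ∈ s) (hpp : ∀ x ∈ s, p (p x) = x) (hq : ∀ x ∈ s, q (p x) ≠ q x)
    (hcard : ∀ x ∈ s, {y ∈ (s : Set α) | q y = q x}.ncard = 3) :
    ∃ c : Q → Bool, ∀ x ∈ s, ∀ y ∈ s, q x = q y → x ≠ y → c (q (p x)) = c (q x) →
      c (q (p y)) = c (q y) → False := by
  classical
  -- The points of `s` are half-edges, so `f` is twice the size of the cut.
  let f : (Q → Bool) → ℕ := fun c => #{x ∈ s | c (q (p x)) ≠ c (q x)}
  have hf : ∀ c, f c ≤ #s := fun c => Finset.card_filter_le _ _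
  obtain ⟨c, hc⟩ : ∃ c, ∀ c', f c' ≤ f c := by
    refine ⟨Function.argmin fun c => #s - f c, fun c' => ?_⟩
    have h1 := Function.argmin_le (fun c => #s - f c) c'
    have h2 := hf c'
    have h3 := hf (Function.argmin fun c => #s - f c)
    omega
  refine ⟨c, fun x hx y hy hxy hne hcx hcy => ?_⟩
  set k := q x with hk
  let c' := Function.update c k (!(c k))
  -- A cut edge at the fibre `k` has one half-edge in that fibre and one outside, which explains the
  -- factor two; the rest does not depend on the colour of `k`.
  have hsplit : ∀ d : Q → Bool, f d = 2 * #{t ∈ s | q t = k ∧ d (q (p t)) ≠ d (q t)} +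
      #{t ∈ s | (q t ≠ k ∧ q (p t) ≠ k) ∧ d (q (p t)) ≠ d (q t)} := by
    intro d
    have h1 : #{t ∈ s | q t = k ∧ d (q (p t)) ≠ d (q t)} =
        #{t ∈ s | q (p t) = k ∧ d (q (p t)) ≠ d (q t)} := by
      refine Finset.card_nbij' p p ?_ ?_ ?_ ?_
      · intro t ht
        simp only [Finset.coe_filter, Set.mem_ofPred_eq] at ht ⊢
        rw [hpp t ht.1]
        exact ⟨hp t ht.1, ht.2.1, ht.2.2.symm⟩
      · intro t ht
        simp only [Finset.coe_filter, Set.mem_ofPred_eq] at ht ⊢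
        rw [hpp t ht.1]
        exact ⟨hp t ht.1, ht.2.1, ht.2.2.symm⟩
      · intro t ht
        exact hpp t (Finset.mem_filter.1 ht).1
      · intro t ht
        exact hpp t (Finset.mem_filter.1 ht).1
    change #{x ∈ s | d (q (p x)) ≠ d (q x)} = _
    rw [two_mul]
    nth_rw 2 [h1]
    rw [← Finset.card_union_of_disjoint, ← Finset.card_union_of_disjoint]
    · congr 1
      ext t
      simp only [Finset.mem_filter, Finset.mem_union]
      tauto
    · rw [Finset.disjoint_left]
      intro t ht
      simp only [Finset.mem_filter, Finset.mem_union] at ht ⊢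
      tauto
    · rw [Finset.disjoint_left]
      intro t ht
      simp only [Finset.mem_filter] at ht ⊢
      have := hq t ht.1
      rintro ⟨-, h2, -⟩
      exact this (h2.trans ht.2.1.symm)
  have h1 := hsplit c
  have h2 := hsplit c'
  have h3 : #{t ∈ s | (q t ≠ k ∧ q (p t) ≠ k) ∧ c' (q (p t)) ≠ c' (q t)} =
      #{t ∈ s | (q t ≠ k ∧ q (p t) ≠ k) ∧ c (q (p t)) ≠ c (q t)} := by
    congr 1
    refine Finset.filter_congr fun t _ => and_congr_right fun ht => ?_
    simp only [c', Function.update_of_ne ht.1, Function.update_of_ne ht.2]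
  have h4 : #{t ∈ s | q t = k ∧ c' (q (p t)) ≠ c' (q t)} =
      #{t ∈ s | q t = k ∧ c (q (p t)) = c (q t)} := by
    congr 1
    refine Finset.filter_congr fun t ht => and_congr_right fun htk => ?_
    have h5 := hq t ht
    rw [htk] at h5
    simp only [c', htk, Function.update_self, Function.update_of_ne h5]
    cases c (q (p t)) <;> cases c k <;> simp
  have h5 : #{t ∈ s | q t = k ∧ c (q (p t)) ≠ c (q t)} +
      #{t ∈ s | q t = k ∧ c (q (p t)) = c (q t)} = 3 := by
    rw [← hcard x hx, ← Finset.card_union_of_disjoint]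
    · rw [← Set.ncard_coe_finset]
      congr 1
      ext t
      simp only [Finset.coe_union, Finset.coe_filter, Set.mem_union, Set.mem_ofPred_eq,
        Finset.mem_coe]
      tauto
    · rw [Finset.disjoint_left]
      intro t ht
      simp only [Finset.mem_filter] at ht ⊢
      tauto
  -- At least two of the three edges at `k` are monochromatic, so recolouring `k` enlarges the cut.
  have h6 : 1 < #{t ∈ s | q t = k ∧ c (q (p t)) = c (q t)} := by
    rw [Finset.one_lt_card]
    exact ⟨x, by simp [hx, hcx, ← hk], y, by simp [hy, hcy, ← hxy], hne⟩
  have h7 := hc c'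
  omega

open scoped Finset in
/-- Representatives of the fibres of `q` in the smaller colour class, avoiding two given points. -/
theorem Finset.exists_representatives_of_involution {α Q : Type*} (s : Finset α) (p : α → α)
    (q : α → Q) (w z : α)
    (hp : ∀ x ∈ s, p x ∈ s) (hpp : ∀ x ∈ s, p (p x) = x) (hq : ∀ x ∈ s, q (p x) ≠ q x)
    (hcard : ∀ x ∈ s, {y ∈ (s : Set α) | q y = q x}.ncard = 3) :
    ∃ (C : Set Q) (D : Finset α), D ⊆ s ∧ w ∉ D ∧ z ∉ D ∧ 6 * #D ≤ #s ∧
      (∀ x ∈ s, q x ∈ C → ∃ d ∈ D, q d = q x) ∧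
      ∀ x ∈ s, ∀ y ∈ s, q x = q y → x ≠ y → q x ∉ C → q (p x) ∉ C → q (p y) ∉ C → False := by
  classical
  obtain ⟨c, hc⟩ := s.exists_coloring_of_involution p q hp hpp hq hcard
  have hs : #s = 3 * #(s.image q) := by
    rw [Finset.card_eq_sum_card_image q s, Finset.sum_const_nat (m := 3), mul_comm]
    intro k hk
    obtain ⟨x, hx, rfl⟩ := Finset.mem_image.1 hk
    rw [← hcard x hx, ← Set.ncard_coe_finset, Finset.coe_filter]
    rfl
  obtain ⟨b, hb⟩ : ∃ b, 2 * #{k ∈ s.image q | c k = b} ≤ #(s.image q) := by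
    have h1 := Finset.card_filter_add_card_filter_not (s := s.image q) (fun k => c k = true)
    simp only [Bool.not_eq_true] at h1
    by_cases h2 : 2 * #{k ∈ s.image q | c k = true} ≤ #(s.image q)
    · exact ⟨true, h2⟩
    · exact ⟨false, by omega⟩
  -- A fibre has three points, one more than the points to be avoided.
  have hrep : ∀ k ∈ s.image q, ∃ d ∈ s, q d = k ∧ d ≠ w ∧ d ≠ z := by
    intro k hk
    obtain ⟨x, hx, rfl⟩ := Finset.mem_image.1 hk
    by_contra! hcon
    have hsub : {y ∈ (s : Set α) | q y = q x} ⊆ (({w, z} : Finset α) : Set α) := by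
      rintro y ⟨hy, hyx⟩
      have := hcon y hy hyx
      simp only [Finset.coe_insert, Finset.coe_singleton, Set.mem_insert_iff,
        Set.mem_singleton_iff]
      tauto
    have h1 := Set.ncard_le_ncard hsub (Finset.finite_toSet _)
    rw [hcard x hx, Set.ncard_coe_finset] at h1
    have := Finset.card_le_two (a := w) (b := z)
    omega
  have : Nonempty α := ⟨w⟩
  choose! g hg using hrep
  refine ⟨{k | c k = b}, {k ∈ s.image q | c k = b}.image g, ?_, ?_, ?_, ?_, ?_, ?_⟩
  · intro d hd
    obtain ⟨k, hk, rfl⟩ := Finset.mem_image.1 hd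
    exact (hg k (Finset.mem_filter.1 hk).1).1
  · intro hd
    obtain ⟨k, hk, hk'⟩ := Finset.mem_image.1 hd
    exact (hg k (Finset.mem_filter.1 hk).1).2.2.1 hk'
  · intro hd
    obtain ⟨k, hk, hk'⟩ := Finset.mem_image.1 hd
    exact (hg k (Finset.mem_filter.1 hk).1).2.2.2 hk'
  · have := Finset.card_image_le (s := {k ∈ s.image q | c k = b}) (f := g)
    omega
  · intro x hx hxC
    have hk : q x ∈ s.image q := Finset.mem_image_of_mem q hx
    exact ⟨g (q x), Finset.mem_image_of_mem g (Finset.mem_filter.2 ⟨hk, hxC⟩), (hg _ hk).2.1⟩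
  · intro x hx y hy hxy hne h1 h2 h3
    have h1' : c (q x) ≠ b := h1
    have h2' : c (q (p x)) ≠ b := h2
    have h3' : c (q (p y)) ≠ b := h3
    refine hc x hx y hy hxy hne ?_ ?_
    · revert h1' h2'; cases c (q x) <;> cases c (q (p x)) <;> cases b <;> simp
    · rw [← hxy]
      revert h1' h3'; cases c (q x) <;> cases c (q (p y)) <;> cases b <;> simp

/-! ### The observation process -/

namespace Graph

variable {α β : Type*} {G : Graph α β}

/-- The edge `e` is observed at some time of the process started from `S`. -/
def EdgeObserved (G : Graph α β) (S : Set α) (e : β) : Prop := ∃ i, e ∈ G.observedEdges S i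

/-- The vertex `x` is observed at some time of the process started from `S`. -/
def VertexObserved (G : Graph α β) (S : Set α) (x : α) : Prop :=
  ∃ i, x ∈ G.observedVertices S (G.observedEdges S i)

variable {S : Set α} {x y : α} {e : β}

theorem observedEdges_mono (G : Graph α β) (S : Set α) : Monotone (G.observedEdges S) :=
  monotone_nat_of_le_succ fun _ _ he => .inl (.inl he)

theorem observedVertices_mono {F F' : Set β} (h : F ⊆ F') :
    G.observedVertices S F ⊆ G.observedVertices S F' := by
  rintro x (hx | ⟨e, he, hex⟩)
  exacts [.inl hx, .inr ⟨e, h he, hex⟩]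

theorem edgeObserved_of_mem (hx : x ∈ S) (he : G.Inc e x) : G.EdgeObserved S e :=
  ⟨0, x, hx, he⟩

theorem EdgeObserved.vertexObserved (h : G.EdgeObserved S e) (he : G.Inc e x) :
    G.VertexObserved S x :=
  h.imp fun _ hi => .inr ⟨e, hi, he⟩

theorem VertexObserved.edgeObserved (hx : G.VertexObserved S x) (hy : G.VertexObserved S y)
    (he : G.IsLink e x y) : G.EdgeObserved S e := by
  obtain ⟨i, hi⟩ := hx
  obtain ⟨j, hj⟩ := hy
  exact ⟨max i j + 1, .inl (.inr ⟨x, y, he,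
    observedVertices_mono (G.observedEdges_mono S (le_max_left i j)) hi,
    observedVertices_mono (G.observedEdges_mono S (le_max_right i j)) hj⟩)⟩

/-- Only finitely many edges meet `x`, so there is one round by which all the others are observed.
-/
theorem IsCubic.edgeObserved (hc : G.IsCubic) (he : G.Inc e x) (hne : ∃ f, f ≠ e ∧ G.Inc f x)
    (h : ∀ f, f ≠ e → G.Inc f x → G.EdgeObserved S f) : G.EdgeObserved S e := by
  have hfin : (G.incidenceSet x).Finite := by
    refine Set.finite_of_encard_le_coe (k := 3) ?_
    exact le_self_add.trans (hc x he.vertex_mem).le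
  have hex : ∀ f, ∃ i, f ≠ e → G.Inc f x → f ∈ G.observedEdges S i := by
    intro f
    by_cases hf : f ≠ e ∧ G.Inc f x
    · exact (h f hf.1 hf.2).imp fun _ hi _ _ => hi
    · exact ⟨0, fun h1 h2 => absurd ⟨h1, h2⟩ hf⟩
  choose i hi using hex
  obtain ⟨N, hN⟩ := (hfin.image i).bddAbove
  exact ⟨N + 1, .inr ⟨x, he, hne, fun f hfe hf =>
    G.observedEdges_mono S (hN (Set.mem_image_of_mem i hf)) (hi f hfe hf)⟩⟩

/-- An edge of the doubled pair is observed only after the third edge at either vertex. -/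
theorem mem_observedEdges_of_doubled {u v : α} {e' : β} (hu : u ∉ S) (hv : v ∉ S)
    (hiu : ∀ k, G.Inc k u → G.IsLink k u v ∨ k = e) (hiv : ∀ k, G.Inc k v → G.IsLink k u v ∨ k = e')
    (hmul : ∀ k, G.IsLink k u v → ∃ k', k' ≠ k ∧ G.IsLink k' u v) (i : ℕ) {k : β}
    (hk : G.IsLink k u v) (hki : k ∈ G.observedEdges S i) : e ∈ G.observedEdges S i := by
  induction i generalizing k with
  | zero =>
    obtain ⟨x, hx, hkx⟩ := hki
    rcases hkx.eq_or_eq_of_isLink hk with rfl | rfl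
    exacts [absurd hx hu, absurd hx hv]
  | succ i ih =>
    refine G.observedEdges_mono S (Nat.le_succ i) ?_
    rcases hki with (hki | ⟨x, y, hxy, hx, hy⟩) | ⟨x, hkx, -, hall⟩
    · exact ih hk hki
    · have huo : u ∈ G.observedVertices S (G.observedEdges S i) := by
        rcases hk.left_eq_or_eq hxy with rfl | rfl <;> assumption
      obtain hh | ⟨f, hf, hfu⟩ := huo
      · exact absurd hh hu
      rcases hiu f hfu with hf' | rfl
      exacts [ih hf' hf, hf]
    -- Whichever end applies the rule, the parallel edge `k'` must already be observed there.
    · obtain ⟨k', hne, hk'⟩ := hmul k hk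
      refine ih hk' (hall k' hne ?_)
      rcases hkx.eq_or_eq_of_isLink hk with rfl | rfl
      exacts [hk'.inc_left, hk'.inc_right]

/-- Consider the round before `e` is first observed. No edge at `u` is observed then, as a doubled
edge would come after `e`; so `u` is unobserved, and `e` can only be forced from `w`. -/
theorem eventuallyObserves_of_doubled {u v w : α} {e' : β} (hu : u ∉ S) (hv : v ∉ S) (hw : w ∉ S)
    (he : G.IsLink e u w) (hew : e ∉ {k | G.IsLink k u v})
    (hiu : ∀ k, G.Inc k u → G.IsLink k u v ∨ k = e) (hiv : ∀ k, G.Inc k v → G.IsLink k u v ∨ k = e')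
    (hmul : ∀ k, G.IsLink k u v → ∃ k', k' ≠ k ∧ G.IsLink k' u v)
    (hpar : ∃ k, G.IsLink k u v)
    (hobs : G.EdgeObserved S e) : G.EventuallyObserves S w u := by
  classical
  have hmin := fun i => Nat.find_min hobs (m := i)
  have hfind := Nat.find_spec hobs
  rcases hi : Nat.find hobs with _ | j
  · rw [hi] at hfind
    obtain ⟨x, hx, hex⟩ := hfind
    rcases hex.eq_or_eq_of_isLink he with rfl | rfl
    exacts [absurd hx hu, absurd hx hw]
  · rw [hi] at hfind
    have hj : e ∉ G.observedEdges S j := hmin j (by omega)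
    have hd := fun k => mem_observedEdges_of_doubled hu hv hiu hiv hmul j (k := k)
    have huo : u ∉ G.observedVertices S (G.observedEdges S j) := by
      rintro (hh | ⟨f, hf, hfu⟩)
      · exact hu hh
      rcases hiu f hfu with hf' | rfl
      exacts [hj (hd f hf' hf), hj hf]
    rcases hfind with (hfind | ⟨x, y, hxy, hx, hy⟩) | ⟨x, hex, ⟨f, hfe, hfx⟩, hall⟩
    · exact absurd hfind hj
    · rcases he.left_eq_or_eq hxy with rfl | rfl
      exacts [absurd hx huo, absurd hy huo]
    · rcases hex.eq_or_eq_of_isLink he with rfl | rfl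
      · obtain ⟨k, hk⟩ := hpar
        refine absurd (hd k hk (hall k ?_ hk.inc_left)) hj
        rintro rfl
        exact hew hk
      · exact ⟨j, e, .inr ⟨f, hall f hfe hfx, hfx⟩, huo, he.symm, hall⟩

/-! ### Propagation through triangles -/

namespace IsTrianglePartition

variable {u v : α} {T : α → Set α} {r : α → α}

/-- If all vertices of a triangle are observed, then so are all edges at its vertices. -/
theorem edgeObserved_of_vertexObserved (hT : G.IsTrianglePartition u v T r) (hc : G.IsCubic)
    (hsimple : ∀ x ∈ G.vertexSet, x ≠ u → x ≠ v → ∀ e f y, G.IsLink e x y → G.IsLink f x y → e = f)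
    (hx : x ∈ G.vertexSet) (hxu : x ≠ u) (hxv : x ≠ v)
    (h : ∀ y ∈ T x, G.VertexObserved S y) : ∀ y ∈ T x, ∀ e, G.Inc e y → G.EdgeObserved S e := by
  intro y hy e he
  obtain ⟨hyV, hyu, hyv, hyT⟩ := ((hT x hx hxu hxv).2.1 y).1 hy
  obtain ⟨t, ht⟩ := he
  rcases hT.mem_or_eq_of_adj hyu hyv ht.adj with htT | rfl
  · exact (h y hy).edgeObserved (h t (hyT ▸ htT)) ht
  · obtain ⟨a, b, hab, hya, hyb, har, hbr, hN, hTy⟩ := (hT y hyV hyu hyv).1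
    refine hc.edgeObserved ht.inc_left ?_ ?_
    · obtain ⟨f, hf⟩ := (hN a).2 (.inl rfl)
      refine ⟨f, ?_, hf.inc_left⟩
      rintro rfl
      exact har (hf.right_unique ht)
    · rintro f hfe ⟨s, hs⟩
      rcases hT.mem_or_eq_of_adj hyu hyv hs.adj with hsT | rfl
      · exact (h y hy).edgeObserved (h s (hyT ▸ hsT)) hs
      · exact absurd (hsimple y hyV hyu hyv _ _ _ hs ht) hfe

/-- If two vertices of a triangle have their outer edges observed, then all edges at the
triangle are observed. -/
theorem edgeObserved_of_two (hT : G.IsTrianglePartition u v T r) (hc : G.IsCubic)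
    (hsimple : ∀ x ∈ G.vertexSet, x ≠ u → x ≠ v → ∀ e f y, G.IsLink e x y → G.IsLink f x y → e = f)
    (hx : x ∈ G.vertexSet) (hxu : x ≠ u) (hxv : x ≠ v) (hy : y ∈ T x) (hyx : y ≠ x)
    (h1 : ∀ e, G.IsLink e x (r x) → G.EdgeObserved S e)
    (h2 : ∀ e, G.IsLink e y (r y) → G.EdgeObserved S e) :
    ∀ y ∈ T x, ∀ e, G.Inc e y → G.EdgeObserved S e := by
  obtain ⟨hyV, hyu, hyv, hyT⟩ := ((hT x hx hxu hxv).2.1 y).1 hy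
  obtain ⟨f, hf⟩ := hT.adj_right hx hxu hxv
  obtain ⟨g, hg⟩ := hT.adj_right hyV hyu hyv
  have hxo := (h1 f hf).vertexObserved hf.inc_left
  have hyo := (h2 g hg).vertexObserved hg.inc_left
  obtain ⟨t, ht, htx, hty, hall⟩ := hT.exists_third hx hxu hxv hy hyx
  obtain ⟨k, hk⟩ := hT.adj_of_mem hx hxu hxv ht htx
  -- At `x` the outer edge and the edge to `y` are observed, so the edge to the third vertex is
  -- forced.
  have hko : G.EdgeObserved S k := by
    refine hc.edgeObserved hk.inc_left ?_ ?_
    · obtain ⟨m, hm⟩ := hT.adj_of_mem hx hxu hxv hy hyx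
      refine ⟨m, ?_, hm.inc_left⟩
      rintro rfl
      exact hty (hk.right_unique hm)
    · rintro m hmk ⟨s, hs⟩
      rcases hT.mem_or_eq_of_adj hxu hxv hs.adj with hsT | rfl
      · rcases hall s hsT with rfl | rfl | rfl
        · exact hxo.edgeObserved hxo hs
        · exact hxo.edgeObserved hyo hs
        · exact absurd (hsimple x hx hxu hxv _ _ _ hs hk) hmk
      · exact h1 m hs
  refine hT.edgeObserved_of_vertexObserved hc hsimple hx hxu hxv fun s hs => ?_
  rcases hall s hs with rfl | rfl | rfl
  exacts [hxo, hyo, hko.vertexObserved hk.inc_right]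

/-- If the set contains a vertex of a triangle, then all edges at the triangle are observed. -/
theorem edgeObserved_of_mem (hT : G.IsTrianglePartition u v T r) (hc : G.IsCubic)
    (hsimple : ∀ x ∈ G.vertexSet, x ≠ u → x ≠ v → ∀ e f y, G.IsLink e x y → G.IsLink f x y → e = f)
    (hx : x ∈ G.vertexSet) (hxu : x ≠ u) (hxv : x ≠ v) (hxS : x ∈ S) :
    ∀ y ∈ T x, ∀ e, G.Inc e y → G.EdgeObserved S e := by
  refine hT.edgeObserved_of_vertexObserved hc hsimple hx hxu hxv fun s hs => ?_
  by_cases hsx : s = x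
  · exact ⟨0, .inl (hsx ▸ hxS)⟩
  · obtain ⟨k, hk⟩ := hT.adj_of_mem hx hxu hxv hs hsx
    exact (Graph.edgeObserved_of_mem hxS hk.inc_left).vertexObserved hk.inc_right

end IsTrianglePartition

/-! ### The bypassed graph -/

/-- Combinatorial form of the hypotheses: the frame of the doubled pair together with its edges. -/
theorem IsUniqueDoubledPair.exists_frame {u v : α} (h : G.IsUniqueDoubledPair u v)
    (hc : G.IsCubic) (h2 : G.TwoEdgeConnected) :
    ∃ w z e e', G.DoubledPairFrame u v w z ∧ G.IsLink e u w ∧ G.IsLink e' v z ∧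
      (∀ k, G.Inc k u → G.IsLink k u v ∨ k = e) ∧ (∀ k, G.Inc k v → G.IsLink k u v ∨ k = e') ∧
      (∀ k, G.IsLink k u v → ∃ k', k' ≠ k ∧ G.IsLink k' u v) ∧ (∃ k, G.IsLink k u v) ∧
      ∀ x ∈ G.vertexSet, x ≠ u → x ≠ v → ∀ e f y, G.IsLink e x y → G.IsLink f x y → e = f := by
  have hl := h2.not_isLink_self hc h.mem.1 h.mem.2 h.1
  obtain ⟨w, f, g, e, hfg, hf, hg, he, hwu, hwv, hu⟩ := h.exists_inc_iff hc hl
  obtain ⟨z, f', g', e', hfg', hf', hg', he', hzv, hzu, hv⟩ := h.symm.exists_inc_iff hc hl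
  have hu' : ∀ k, G.Inc k u → G.IsLink k u v ∨ k = e := by
    intro k hk
    rcases hu k hk with rfl | rfl | rfl <;> tauto
  have hv' : ∀ k, G.Inc k v → G.IsLink k u v ∨ k = e' := by
    intro k hk
    rcases hv k hk with rfl | rfl | rfl
    exacts [.inl hf'.symm, .inl hg'.symm, .inr rfl]
  refine ⟨w, z, e, e', ⟨?_, ?_, ?_, h.1, ⟨hwu, hwv⟩, ⟨hzu, hzv⟩, ?_, ?_⟩, he, he', hu', hv', ?_,
    ⟨f, hf⟩, fun x hx hxu hxv => (h.exists_adj_iff hc h2 hl hx hxu hxv).2⟩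
  · rintro x ⟨k, hk⟩
    exact hl k x hk
  · intro y
    constructor
    · rintro ⟨k, hk⟩
      rcases hu' k hk.inc_left with hk' | rfl
      exacts [.inl (hk.right_unique hk'), .inr (hk.right_unique he)]
    · rintro (rfl | rfl)
      exacts [⟨f, hf⟩, ⟨e, he⟩]
  · intro y
    constructor
    · rintro ⟨k, hk⟩
      rcases hv' k hk.inc_left with hk' | rfl
      exacts [.inl (hk.right_unique hk'.symm), .inr (hk.right_unique he')]
    · rintro (rfl | rfl)
      exacts [⟨f, hf.symm⟩, ⟨e', he'⟩]
  · exact fun x hx hxu hxv => (h.exists_adj_iff hc h2 hl hx hxu hxv).1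
  · intro W a b x y hau hav hx hxW hy hyW
    by_cases hab : ∃ k, G.IsLink k a b
    · obtain ⟨k, hk⟩ := hab
      obtain ⟨m, p, q, hmk, hm, hp, hq⟩ := h2.exists_isLink_boundary k W hx hxW hy hyW
      refine ⟨p, q, hm.adj, hp, hq, ?_⟩
      rintro ⟨rfl, rfl⟩
      exact hmk ((h.exists_adj_iff hc h2 hl hm.left_mem hau hav).2 _ _ _ hm hk)
    · obtain ⟨m, p, q, -, hm, hp, hq⟩ := h2.exists_isLink_boundary f W hx hxW hy hyW
      refine ⟨p, q, hm.adj, hp, hq, ?_⟩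
      rintro ⟨rfl, rfl⟩
      exact hab ⟨m, hm⟩
  · intro k hk
    by_cases hkf : k = f
    · exact ⟨g, hkf ▸ hfg.symm, hg⟩
    · exact ⟨f, fun hh => hkf hh.symm, hf⟩

open Classical in
/-- The involution on the vertices off the doubled pair that replaces the path through the pair
by an edge from `w` to `z`. -/
noncomputable def bypass (r : α → α) (w z : α) (x : α) : α :=
  if x = w then z else if x = z then w else r x

theorem bypass_of_ne {r : α → α} {w z x : α} (hw : x ≠ w) (hz : x ≠ z) : bypass r w z x = r x := by
  simp [bypass, hw, hz]

theorem bypass_left {r : α → α} {w z : α} : bypass r w z w = z := by simp [bypass]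

theorem bypass_right {r : α → α} {w z : α} : bypass r w z z = w := by
  by_cases h : z = w
  · simp [bypass, h]
  · simp [bypass, h]

/-- A set that meets all triangles in `C` observes all edges off the doubled pair, if each triangle
not in `C` has at most one vertex whose partner lies in a triangle not in `C`. -/
theorem IsTrianglePartition.edgeObserved {u v w z : α} {T : α → Set α} {r : α → α}
    (hT : G.IsTrianglePartition u v T r) (h : G.DoubledPairFrame u v w z) (hc : G.IsCubic)
    (hsimple : ∀ x ∈ G.vertexSet, x ≠ u → x ≠ v → ∀ e f y, G.IsLink e x y → G.IsLink f x y → e = f)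
    {s : Set α} (hs : ∀ x, x ∈ s ↔ x ∈ G.vertexSet ∧ x ≠ u ∧ x ≠ v)
    (hps : ∀ x ∈ s, bypass r w z x ∈ s)
    (hpne : ∀ x ∈ s, T (bypass r w z x) ≠ T x)
    {C : Set (Set α)} {S : Set α} (hSs : S ⊆ s) (hC : ∀ x ∈ s, T x ∈ C → ∃ d ∈ S, T d = T x)
    (hsel : ∀ x ∈ s, ∀ y ∈ s, T x = T y → x ≠ y → T x ∉ C → T (bypass r w z x) ∉ C →
      T (bypass r w z y) ∉ C → False) {x : α} (hx : x ∈ s) :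
    ∀ y ∈ T x, ∀ e, G.Inc e y → G.EdgeObserved S e := by
  have hself : ∀ x ∈ s, x ∈ T x := fun x hx => by
    obtain ⟨h1, h2, h3⟩ := (hs x).1 hx
    exact hT.self_mem h1 h2 h3
  have hmem : ∀ x ∈ s, ∀ y, y ∈ T x ↔ y ∈ s ∧ T y = T x := fun x hx y => by
    obtain ⟨h1, h2, h3⟩ := (hs x).1 hx
    rw [(hT x h1 h2 h3).2.1 y, hs]
    tauto
  have hthree : ∀ x ∈ s, ∃ a ∈ s, ∃ b ∈ s, x ≠ a ∧ x ≠ b ∧ a ≠ b ∧ T a = T x ∧ T b = T x := by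
    intro x hx
    obtain ⟨h1, h2, h3⟩ := (hs x).1 hx
    obtain ⟨a, b, hab, hxa, hxb, -, -, -, hTx⟩ := (hT x h1 h2 h3).1
    obtain ⟨ha, ha'⟩ := (hmem x hx a).1 (by simp [hTx])
    obtain ⟨hb, hb'⟩ := (hmem x hx b).1 (by simp [hTx])
    exact ⟨a, ha, b, hb, hxa, hxb, hab, ha', hb'⟩
  have hcol : ∀ x ∈ s, T x ∈ C → ∀ y ∈ T x, ∀ e, G.Inc e y → G.EdgeObserved S e := by
    intro x hx hxC
    obtain ⟨d, hd, hdx⟩ := hC x hx hxC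
    obtain ⟨h1, h2, h3⟩ := (hs d).1 (hSs hd)
    rw [← hdx]
    exact hT.edgeObserved_of_mem hc hsimple h1 h2 h3 hd
  have htwo : ∀ x ∈ s, ∀ y ∈ s, T x = T y → x ≠ y → r x ∈ s → r y ∈ s →
      (∀ t ∈ T (r x), ∀ e, G.Inc e t → G.EdgeObserved S e) →
      (∀ t ∈ T (r y), ∀ e, G.Inc e t → G.EdgeObserved S e) →
      ∀ t ∈ T x, ∀ e, G.Inc e t → G.EdgeObserved S e := by
    intro x hx y hy hxy hne hrx hry h1 h2
    obtain ⟨k1, k2, k3⟩ := (hs x).1 hx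
    exact hT.edgeObserved_of_two hc hsimple k1 k2 k3 ((hmem x hx y).2 ⟨hy, hxy.symm⟩) hne.symm
      (fun e he => h1 _ (hself _ hrx) e he.inc_right)
      (fun e he => h2 _ (hself _ hry) e he.inc_right)
  have hpr : ∀ x ∈ s, x ≠ w → x ≠ z → r x ∈ s := by
    intro x hx hxw hxz
    have := hps x hx
    rwa [bypass_of_ne hxw hxz] at this
  -- At these triangles `bypass r w z` agrees with `r`, so the selection speaks of genuine edges:
  -- two of the three lead to `C`.
  have hfar : ∀ x ∈ s, T x ≠ T w → T x ≠ T z →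
      ∀ y ∈ T x, ∀ e, G.Inc e y → G.EdgeObserved S e := by
    intro x hx hxw hxz
    by_cases hxC : T x ∈ C
    · exact hcol x hx hxC
    have hby : ∀ t ∈ s, T t = T x → r t ∈ s ∧ bypass r w z t = r t := by
      intro t ht htx
      have htw : t ≠ w := by rintro rfl; exact hxw htx.symm
      have htz : t ≠ z := by rintro rfl; exact hxz htx.symm
      exact ⟨hpr t ht htw htz, bypass_of_ne htw htz⟩
    have hsel' : ∀ t ∈ s, T t = T x → ∀ t' ∈ s, T t' = T x → t ≠ t' → T (r t) ∉ C →
        T (r t') ∉ C → False := by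
      intro t ht htx t' ht' htx' hne h1 h2
      rw [← (hby t ht htx).2] at h1
      rw [← (hby t' ht' htx').2] at h2
      exact hsel t ht t' ht' (htx.trans htx'.symm) hne (htx ▸ hxC) h1 h2
    have hfin : ∀ t ∈ s, T t = T x → ∀ t' ∈ s, T t' = T x → t ≠ t' → T (r t) ∈ C →
        T (r t') ∈ C → ∀ y ∈ T x, ∀ e, G.Inc e y → G.EdgeObserved S e := by
      intro t ht htx t' ht' htx' hne h1 h2
      rw [← htx]
      have k1 := (hby t ht htx).1
      have k2 := (hby t' ht' htx').1
      exact htwo t ht t' ht' (htx.trans htx'.symm) hne k1 k2 (hcol _ k1 h1) (hcol _ k2 h2)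
    obtain ⟨a, ha, b, hb, hxa, hxb, hab, hTa, hTb⟩ := hthree x hx
    by_cases h1 : T (r x) ∈ C
    · by_cases h2 : T (r a) ∈ C
      · exact hfin x hx rfl a ha hTa hxa h1 h2
      · refine hfin x hx rfl b hb hTb hxb h1 ?_
        by_contra h3
        exact hsel' a ha hTa b hb hTb hab h2 h3
    · refine hfin a ha hTa b hb hTb hab ?_ ?_
      · by_contra h2
        exact hsel' x hx rfl a ha hTa hxa h1 h2
      · by_contra h2
        exact hsel' x hx rfl b hb hTb hxb h1 h2
  have hws : w ∈ s := (hs w).2 ⟨h.left_nbr_mem, h.left_ne⟩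
  have hzs : z ∈ s := (hs z).2 ⟨h.symm.left_nbr_mem, h.right_ne⟩
  have hwz := hT.class_ne h
  -- Here the edge from `t` to `t'` is fictitious, so the triangle of `t` has to be observed through
  -- its other two vertices.
  have hnear : ∀ t t', t = w ∧ t' = z ∨ t = z ∧ t' = w →
      ∀ y ∈ T t, ∀ e, G.Inc e y → G.EdgeObserved S e := by
    intro t t' htt
    have ht : t ∈ s := by rcases htt with ⟨rfl, -⟩ | ⟨rfl, -⟩ <;> assumption
    have hpt : bypass r w z t = t' := by
      rcases htt with ⟨rfl, rfl⟩ | ⟨rfl, rfl⟩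
      exacts [bypass_left, bypass_right]
    by_cases htC : T t ∈ C
    · exact hcol t ht htC
    have hkey : ∀ a ∈ s, t ≠ a → T a = T t →
        r a ∈ s ∧ ∀ y ∈ T (r a), ∀ e, G.Inc e y → G.EdgeObserved S e := by
      intro a ha hta hTa
      have haw : a ≠ w ∧ a ≠ z := by
        rcases htt with ⟨rfl, rfl⟩ | ⟨rfl, rfl⟩
        · exact ⟨hta.symm, by rintro rfl; exact hwz hTa⟩
        · exact ⟨by rintro rfl; exact hwz hTa.symm, hta.symm⟩
      have hra := hpr a ha haw.1 haw.2
      refine ⟨hra, ?_⟩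
      by_cases hraC : T (r a) ∈ C
      · exact hcol _ hra hraC
      have h1 : T (r a) ≠ T t := by
        have := hpne a ha
        rwa [bypass_of_ne haw.1 haw.2, hTa] at this
      -- Otherwise both `t` and `a` have partners in the triangle of `t'`, which is not in `C`,
      -- against the selection. So `T (r a)` is covered by `hfar`, and there is no circularity.
      have h2 : T (r a) ≠ T t' := by
        intro hh
        refine hsel t ht a ha hTa.symm hta htC ?_ ?_
        · rw [hpt, ← hh]; exact hraC
        · rw [bypass_of_ne haw.1 haw.2]; exact hraC
      rcases htt with ⟨rfl, rfl⟩ | ⟨rfl, rfl⟩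
      exacts [hfar _ hra h1 h2, hfar _ hra h2 h1]
    obtain ⟨a, ha, b, hb, hta, htb, hab, hTa, hTb⟩ := hthree t ht
    obtain ⟨ka, ka'⟩ := hkey a ha hta hTa
    obtain ⟨kb, kb'⟩ := hkey b hb htb hTb
    have := htwo a ha b hb (hTa.trans hTb.symm) hab ka kb ka' kb'
    rwa [hTa] at this
  by_cases h1 : T x = T w
  · rw [h1]; exact hnear w z (.inl ⟨rfl, rfl⟩)
  by_cases h2 : T x = T z
  · rw [h2]; exact hnear z w (.inr ⟨rfl, rfl⟩)
  exact hfar x hx h1 h2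

/-- As `r w = u` and `r z = v`, the map `r` sends no other vertex off the pair to `w` or `z`;
swapping these two therefore still gives an involution. -/
theorem IsTrianglePartition.bypass_spec {u v w z : α} {T : α → Set α} {r : α → α}
    (hT : G.IsTrianglePartition u v T r) (h : G.DoubledPairFrame u v w z) {x : α}
    (hx : x ∈ G.vertexSet) (hxu : x ≠ u) (hxv : x ≠ v) :
    (bypass r w z x ∈ G.vertexSet ∧ bypass r w z x ≠ u ∧ bypass r w z x ≠ v) ∧
      bypass r w z (bypass r w z x) = x ∧ T (bypass r w z x) ≠ T x := by
  by_cases hxw : x = w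
  · rw [hxw, bypass_left, bypass_right]
    exact ⟨⟨h.symm.left_nbr_mem, h.right_ne⟩, rfl, hT.class_ne h⟩
  by_cases hxz : x = z
  · rw [hxz, bypass_right, bypass_left]
    exact ⟨⟨h.left_nbr_mem, h.left_ne⟩, rfl, (hT.class_ne h).symm⟩
  rw [bypass_of_ne hxw hxz]
  have hadj := hT.adj_right hx hxu hxv
  have hu : r x ≠ u := by
    intro hh
    rw [hh] at hadj
    have := (h.adj_left x).1 hadj.symm
    tauto
  have hv : r x ≠ v := by
    intro hh
    rw [hh] at hadj
    have := (h.adj_right x).1 hadj.symm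
    tauto
  obtain ⟨h1, h2⟩ := (hT x hx hxu hxv).2.2 hu hv
  have hw : r x ≠ w := by
    intro hh
    rw [hh, hT.right_left h] at h2
    exact hxu h2.symm
  have hz : r x ≠ z := by
    intro hh
    rw [hh, hT.symm.right_left h.symm] at h2
    exact hxv h2.symm
  rw [bypass_of_ne hw hz]
  exact ⟨⟨hadj.right_mem, hu, hv⟩, h2, h1⟩

end Graph

/-! ### Conclusion -/

theorem corollary2p8 {α β : Type*} (G : Graph α β) (hfin : G.vertexSet.Finite)
    (hcubic : G.IsCubic) (hconn : G.TwoEdgeConnected)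
    (hclaw : G.ClawFree) (hdiamond : G.DiamondFree)
    (u v : α) (huv : G.IsUniqueDoubledPair u v) :
    (G.powerDominationNumber : ℚ) ≤ ((G.vertexSet.ncard : ℚ) - 2) / 6 ∧
    ∃ w z : α, w ≠ u ∧ w ≠ v ∧ z ≠ u ∧ z ≠ v ∧
      {x | G.Adj u x} = {v, w} ∧ {x | G.Adj v x} = {u, z} ∧
      ∃ D : Finset α, G.IsPowerDominating (D : Set α) ∧
        (D.card : ℚ) ≤ ((G.vertexSet.ncard : ℚ) - 2) / 6 ∧
        u ∉ D ∧ v ∉ D ∧ w ∉ D ∧ z ∉ D ∧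
        G.EventuallyObserves (D : Set α) w u ∧ G.EventuallyObserves (D : Set α) z v := by
  classical
  obtain ⟨w, z, e, e', h, he, he', hiu, hiv, hmul, ⟨k, hk⟩, hsimple⟩ :=
    huv.exists_frame hcubic hconn
  obtain ⟨T, r, hT⟩ := h.exists_isTrianglePartition hclaw hdiamond
  let s : Finset α := hfin.toFinset \ {u, v}
  have hs : ∀ x, x ∈ s ↔ x ∈ G.vertexSet ∧ x ≠ u ∧ x ≠ v := by
    intro x
    simp [s]
  have hscard : s.card + 2 = G.vertexSet.ncard := by
    have hsub : ({u, v} : Finset α) ⊆ hfin.toFinset := by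
      intro x hx
      simp only [Finset.mem_insert, Finset.mem_singleton] at hx
      rw [Set.Finite.mem_toFinset]
      rcases hx with rfl | rfl
      exacts [huv.mem.1, huv.mem.2]
    rw [Set.ncard_eq_toFinset_card _ hfin, ← Finset.card_sdiff_add_card_eq_card hsub,
      Finset.card_pair huv.1]
  have hspec := fun x (hx : x ∈ s) =>
    hT.bypass_spec h ((hs x).1 hx).1 ((hs x).1 hx).2.1 ((hs x).1 hx).2.2
  have hps : ∀ x ∈ s, Graph.bypass r w z x ∈ s := fun x hx => (hs _).2 (hspec x hx).1
  obtain ⟨C, D, hDs, hwD, hzD, hcard, hC, hsel⟩ :=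
    s.exists_representatives_of_involution (Graph.bypass r w z) T w z hps
      (fun x hx => (hspec x hx).2.1) (fun x hx => (hspec x hx).2.2) (by
        intro x hx
        obtain ⟨h1, h2, h3⟩ := (hs x).1 hx
        have h4 : {y ∈ (s : Set α) | T y = T x} = T x := by
          ext y
          rw [(hT x h1 h2 h3).2.1 y]
          simp only [Set.mem_ofPred_eq, Finset.mem_coe, hs]
          tauto
        obtain ⟨a, b, hab, hxa, hxb, -, -, -, hTx⟩ := (hT x h1 h2 h3).1
        rw [h4, Set.ncard_eq_three]
        exact ⟨x, a, b, hxa, hxb, hab, hTx⟩)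
  have huD : u ∉ D := fun hh => ((hs u).1 (hDs hh)).2.1 rfl
  have hvD : v ∉ D := fun hh => ((hs v).1 (hDs hh)).2.2 rfl
  have hobs : ∀ x ∈ G.vertexSet, x ≠ u → x ≠ v → ∀ f, G.Inc f x →
      G.EdgeObserved (D : Set α) f := by
    intro x hx hxu hxv f hf
    exact hT.edgeObserved h hcubic hsimple (s := (s : Set α)) hs hps (fun x hx => (hspec x hx).2.2)
      (Finset.coe_subset.2 hDs) hC hsel ((hs x).2 ⟨hx, hxu, hxv⟩) x (hT.self_mem hx hxu hxv) f hf
  have heo : G.EdgeObserved (D : Set α) e :=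
    hobs w h.left_nbr_mem h.left_ne.1 h.left_ne.2 e he.inc_right
  have heo' : G.EdgeObserved (D : Set α) e' :=
    hobs z h.symm.left_nbr_mem h.right_ne.1 h.right_ne.2 e' he'.inc_right
  -- The third edges at `u` and `v` make both vertices observed, whence the doubled edges follow as
  -- edges between observed vertices.
  have huo := heo.vertexObserved he.inc_left
  have hvo := heo'.vertexObserved he'.inc_left
  have hall : ∀ f ∈ G.edgeSet, G.EdgeObserved (D : Set α) f := by
    intro f hf
    obtain ⟨x, y, hxy⟩ := Graph.exists_isLink_of_mem_edgeSet hf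
    by_cases hxu : x = u
    · subst hxu
      rcases hiu f hxy.inc_left with hf' | rfl
      exacts [huo.edgeObserved hvo hf', heo]
    by_cases hxv : x = v
    · subst hxv
      rcases hiv f hxy.inc_left with hf' | rfl
      exacts [huo.edgeObserved hvo hf', heo']
    exact hobs x hxy.left_mem hxu hxv f hxy.inc_left
  have hdom : G.IsPowerDominating (D : Set α) := by
    refine ⟨fun x hx => ((hs x).1 (hDs hx)).1, fun x hx => ?_, hall⟩
    by_cases hxu : x = u
    · exact hxu ▸ huo
    by_cases hxv : x = v
    · exact hxv ▸ hvo
    obtain ⟨f, hf⟩ := hT.adj_right hx hxu hxv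
    exact (hobs x hx hxu hxv f hf.inc_left).vertexObserved hf.inc_left
  have hle : (D.card : ℚ) ≤ ((G.vertexSet.ncard : ℚ) - 2) / 6 := by
    rw [← hscard, le_div_iff₀ (by norm_num)]
    push_cast
    have : (6 * D.card : ℚ) ≤ s.card := by exact_mod_cast hcard
    linarith
  refine ⟨?_, w, z, h.left_ne.1, h.left_ne.2, h.right_ne.1, h.right_ne.2, ?_, ?_, D, hdom, hle,
    huD, hvD, hwD, hzD, ?_, ?_⟩
  · refine le_trans ?_ hle
    have hinf : G.powerDominationNumber ≤ D.card := Nat.sInf_le ⟨D, hdom, rfl⟩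
    exact_mod_cast hinf
  · ext x
    simpa using h.adj_left x
  · ext x
    simpa using h.adj_right x
  · exact Graph.eventuallyObserves_of_doubled (by simpa using huD) (by simpa using hvD)
      (by simpa using hwD) he (fun hh => h.left_ne.2 (he.right_unique hh)) hiu hiv hmul ⟨k, hk⟩ heo
  · have hsw : ∀ k, G.IsLink k u v ↔ G.IsLink k v u := fun k => Graph.isLink_comm
    simp only [hsw] at hiu hiv hmul hk
    exact Graph.eventuallyObserves_of_doubled (by simpa using hvD) (by simpa using huD)
      (by simpa using hzD) he' (fun hh => h.right_ne.1 (he'.right_unique hh)) hiv hiu hmul ⟨k, hk⟩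
      heo'
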